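/- For unit vectors $x,y\in\mathbb S^2=\{x\in\mathbb R^3:\|x\|=1\}$ with $y\neq\pm x$, let $\operatorname{dist}(x,y)=\arccos\langle x,y\rangle$ and let $$\gamma_{x,y}(s)=\frac{\sin((1-s)\operatorname{dist}(x,y))}{\sin(\operatorname{dist}(x,y))}\,x+\frac{\sin(s\operatorname{dist}(x,y))}{\sin(\operatorname{dist}(x,y))}\,y,\qquad s\in[0,1],$$ be the geodesic arc from $x$ to $y$. Points $x_1,\dots,x_n\in\mathbb S^2$ with $x_{j+1}\neq\pm x_j$ for $j=1,\dots,n$, where $x_{n+1}:=x_1$, induce the geodesic cycle $\gamma=(\gamma_{x_j,x_{j+1}})_{j=1}^n$. Put $$\int_\gamma f=\sum_{j=1}^n\int_0^1 f(\gamma_{x_j,x_{j+1}}(s))\,\|\dot\gamma_{x_j,x_{j+1}}(s)\|\,\mathrm ds,\qquad \ell(\gamma)=\int_\gamma 1 .$$ The cycle $\gamma$ is called a geodesic $t$-design cycle if $$\frac1{\ell(\gamma)}\int_\gamma f=\int_{\mathbb S^2}f$$ for all real polynomials $f$ in three variables of total degree at most $t$, where the surface measure on $\mathbb S^2$ is normalized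 to total mass $1$. For $0<\alpha<\beta$ with $\alpha^2+\beta^2<1$ and $q=\sqrt{1-\alpha^2-\beta^2}$, let $\gamma^{(\alpha,\beta)}$ be the geodesic cycle induced by the eight control points $$x_1=(\alpha,\beta,q),\quad x_2=(\beta,\alpha,-q),\quad x_3=(-\beta,\alpha,-q),\quad x_4=(-\alpha,\beta,q),$$ $$x_5=(-\alpha,-\beta,q),\quad x_6=(-\beta,-\alpha,-q),\quad x_7=(\beta,-\alpha,-q),\quad x_8=(\alpha,-\beta,q).$$ **Theorem.** There exist $\alpha_0\in[\frac14,\frac25]$ and $\beta_0\in[\frac12,\frac9{10}]$ such that $\gamma^{(\alpha_0,\beta_0)}$ is a geodesic $3$-design cycle. -/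

import Mathlib

open MeasureTheory

noncomputable section

namespace GeodesicCycle

/-- The angular distance `arccos ⟨x, y⟩` of two points on the unit sphere. -/
def angDist {d : ℕ} (x y : EuclideanSpace ℝ (Fin (d + 1))) : ℝ :=
  Real.arccos (inner ℝ x y)

/-- The constant-speed parametrization on `[0, 1]` of the geodesic arc from `x` to `y`, for unit
vectors `x`, `y` with `y ≠ x` and `y ≠ -x`. -/
def arc {d : ℕ} (x y : EuclideanSpace ℝ (Fin (d + 1))) (s : ℝ) :
    EuclideanSpace ℝ (Fin (d + 1)) :=
  (Real.sin ((1 - s) * angDist x y) / Real.sin (angDist x y)) • x +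
    (Real.sin (s * angDist x y) / Real.sin (angDist x y)) • y

/-- The path integral `∫₀¹ f (γ s) ‖γ' s‖ ds` along a curve parametrized on `[0, 1]`. -/
def pathIntegral {d : ℕ} (γ : ℝ → EuclideanSpace ℝ (Fin (d + 1)))
    (f : EuclideanSpace ℝ (Fin (d + 1)) → ℝ) : ℝ :=
  ∫ s in (0 : ℝ)..1, f (γ s) * ‖deriv γ s‖

/-- The points `x 0, …, x (n - 1)` are admissible control points of a geodesic cycle: they lie on
the unit sphere, and cyclically consecutive ones are joined by a unique nondegenerate geodesic arc
(they are neither equal nor antipodal). Addition on `Fin n` is modulo `n`, so that the point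
following the last one is the first one. Nonconsecutive points may coincide. -/
def IsControl {d n : ℕ} [NeZero n] (x : Fin n → EuclideanSpace ℝ (Fin (d + 1))) : Prop :=
  (∀ j, ‖x j‖ = 1) ∧ ∀ j, x (j + 1) ≠ x j ∧ x (j + 1) ≠ -x j

/-- The path integral over the geodesic cycle with control points `x 0, …, x (n - 1)`, which
traverses the arcs from `x j` to `x (j + 1)`, closing up with the arc from `x (n - 1)` to `x 0`. -/
def cycleIntegral {d n : ℕ} [NeZero n] (x : Fin n → EuclideanSpace ℝ (Fin (d + 1)))
    (f : EuclideanSpace ℝ (Fin (d + 1)) → ℝ) : ℝ :=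
  ∑ j, pathIntegral (arc (x j) (x (j + 1))) f

/-- The arc length of the geodesic cycle with control points `x 0, …, x (n - 1)`. -/
def cycleLength {d n : ℕ} [NeZero n] (x : Fin n → EuclideanSpace ℝ (Fin (d + 1))) : ℝ :=
  cycleIntegral x fun _ => 1

/-- The integral over the unit sphere in `ℝ^(d+1)` with respect to the surface measure, normalized
to total mass one. -/
def sphereIntegral {d : ℕ} (f : EuclideanSpace ℝ (Fin (d + 1)) → ℝ) : ℝ :=
  ⨍ u : Metric.sphere (0 : EuclideanSpace ℝ (Fin (d + 1))) 1, f u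
    ∂((volume : Measure (EuclideanSpace ℝ (Fin (d + 1)))).toSphere)

/-- The points `x 0, …, x (n - 1)` are control points of a geodesic `t`-design cycle: the mean over
the cycle of every real polynomial in `d + 1` variables of total degree at most `t` equals its mean
over the sphere. -/
def IsDesign {d n : ℕ} [NeZero n] (t : ℕ) (x : Fin n → EuclideanSpace ℝ (Fin (d + 1))) : Prop :=
  IsControl x ∧ ∀ p : MvPolynomial (Fin (d + 1)) ℝ, p.totalDegree ≤ t →
    1 / cycleLength x * cycleIntegral x (fun y => MvPolynomial.eval (fun i => y i) p) =
      sphereIntegral fun y => MvPolynomial.eval (fun i => y i) p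

/-- The eight control points on the two-sphere with parameters `α`, `β`, where `0 < α < β` and
`α ^ 2 + β ^ 2 < 1`. The third coordinates are `± q` with `q = √(1 - α ^ 2 - β ^ 2)`. -/
def cubePoints (α β : ℝ) : Fin 8 → EuclideanSpace ℝ (Fin (2 + 1)) :=
  let q := Real.sqrt (1 - α ^ 2 - β ^ 2)
  ![!₂[α, β, q], !₂[β, α, -q], !₂[-β, α, -q], !₂[-α, β, q],
    !₂[-α, -β, q], !₂[-β, -α, -q], !₂[β, -α, -q], !₂[α, -β, q]]

end GeodesicCycle

end

/-!
The control points are permuted by a group of order eight, generated by the sign changes of the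
first two coordinates and by `(x, y, z) ↦ (y, x, -z)`. The group preserves the cycle and the
sphere, so only the invariant part of a polynomial matters (`orbitSum`). In degree at most three,
this part is on the sphere a combination of `1`, `z ^ 2` and `z * (x ^ 2 - y ^ 2)`
(`exists_orbitSum_eval`), with spherical means `1`, `1 / 3` and `0`. The cycle is therefore a
`3`-design as soon as the integrals of `z ^ 2 - 1 / 3` and of `z * (x ^ 2 - y ^ 2)` over it
vanish.

The group has two orbits on the arcs, and both integrals are elementary when each arc is
parametrized by arc length from its midpoint (`pathIntegral_arc`, `cycleIntegral_of_orbitSum`). Up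
to positive factors they are `evenMoment α β` and `oddMoment α β`. For `β ∈ [3/5, 15/17]`,
`oddMoment` is strictly increasing in `α ∈ [1/4, 2/5]` and changes sign there, so its zero set is
a graph over the `β`-interval. Along this graph `evenMoment` is nonnegative at `β = 3/5` and
nonpositive at `β = 15/17`, both numbers being chosen as sines of angles with rational cosines. By
connectedness (`exists_common_zero`) both moments vanish together somewhere.
-/

namespace GeodesicCycle

/-! ### Arcs in terms of their midpoint -/

section Arc

variable {d : ℕ} {x y m w : EuclideanSpace ℝ (Fin (d + 1))} {k : ℝ}

/-- The geodesic arc with midpoint `m`, unit tangent `w` at the midpoint and half-angle `k`. -/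
theorem arc_eq_cos_smul_add_sin_smul (hm : ‖m‖ = 1) (hw : ‖w‖ = 1) (hmw : inner ℝ m w = 0)
    (hk : 0 < k) (hk' : k < Real.pi / 2) (hx : x = Real.cos k • m - Real.sin k • w)
    (hy : y = Real.cos k • m + Real.sin k • w) (s : ℝ) :
    arc x y s = Real.cos ((2 * s - 1) * k) • m + Real.sin ((2 * s - 1) * k) • w := by
  have hin : inner ℝ x y = Real.cos (2 * k) := by
    rw [hx, hy]
    simp only [inner_sub_left, inner_add_right, real_inner_smul_left, real_inner_smul_right, hmw,
      real_inner_comm m w, real_inner_self_eq_norm_sq, norm_smul, mul_pow, Real.norm_eq_abs,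
      sq_abs, hm, hw, Real.cos_two_mul]
    have := Real.sin_sq_add_cos_sq k
    linear_combination -this
  have hang : angDist x y = 2 * k := by
    rw [angDist, hin, Real.arccos_cos (by linarith) (by linarith)]
  have hs : 0 < Real.sin k := Real.sin_pos_of_pos_of_lt_pi hk (by linarith)
  have hc : 0 < Real.cos k := Real.cos_pos_of_mem_Ioo ⟨by linarith, hk'⟩
  have e1 : (1 - s) * (2 * k) = k - (2 * s - 1) * k := by ring
  have e2 : s * (2 * k) = k + (2 * s - 1) * k := by ring
  rw [arc, hang, e1, e2, Real.sin_two_mul, Real.sin_sub, Real.sin_add, hx, hy]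
  match_scalars <;> field_simp <;> ring

/-- Integration over an arc by arc length `φ` from the midpoint, the two halves being folded
together. The range `k < π / 2` keeps the angle `2 * k` between the end points below `π`. -/
theorem pathIntegral_arc (hm : ‖m‖ = 1) (hw : ‖w‖ = 1) (hmw : inner ℝ m w = 0)
    (hk : 0 < k) (hk' : k < Real.pi / 2) (hx : x = Real.cos k • m - Real.sin k • w)
    (hy : y = Real.cos k • m + Real.sin k • w)
    {f : EuclideanSpace ℝ (Fin (d + 1)) → ℝ} (hf : Continuous f) :
    pathIntegral (arc x y) f = ∫ φ in (0 : ℝ)..k, (f (Real.cos φ • m + Real.sin φ • w) +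
      f (Real.cos φ • m - Real.sin φ • w)) := by
  have harc : arc x y = fun s => Real.cos ((2 * s - 1) * k) • m + Real.sin ((2 * s - 1) * k) • w :=
    funext (arc_eq_cos_smul_add_sin_smul hm hw hmw hk hk' hx hy)
  have hder : ∀ s, ‖deriv (arc x y) s‖ = 2 * k := by
    intro s
    have h0 : HasDerivAt (fun s : ℝ => (2 * s - 1) * k) (2 * k) s := by
      simpa using (((hasDerivAt_id s).const_mul 2).sub_const 1).mul_const k
    have h1 := ((h0.cos).smul_const m).add ((h0.sin).smul_const w)
    have h2 : HasDerivAt (arc x y) ((-Real.sin ((2 * s - 1) * k) * (2 * k)) • m +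
        (Real.cos ((2 * s - 1) * k) * (2 * k)) • w) s := by
      rw [harc]; exact h1
    rw [h2.deriv]
    have h3 : ‖(-Real.sin ((2 * s - 1) * k) * (2 * k)) • m +
        (Real.cos ((2 * s - 1) * k) * (2 * k)) • w‖ ^ 2 = (2 * k) ^ 2 := by
      rw [← real_inner_self_eq_norm_sq]
      simp only [inner_add_left, inner_add_right, real_inner_smul_left, real_inner_smul_right, hmw,
        real_inner_comm m w, real_inner_self_eq_norm_sq, norm_smul, mul_pow, Real.norm_eq_abs,
        sq_abs, hm, hw]
      linear_combination (2 * k) ^ 2 * Real.sin_sq_add_cos_sq ((2 * s - 1) * k)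
    exact (sq_eq_sq₀ (norm_nonneg _) (by linarith)).1 h3
  set g : ℝ → ℝ := fun φ => f (Real.cos φ • m + Real.sin φ • w) with hg
  have hgc : Continuous g := by fun_prop
  -- Substitute `φ = (2 * s - 1) * k`; the speed `2 * k` is the Jacobian.
  have h4 : pathIntegral (arc x y) f = ∫ φ in (-k)..k, g φ := by
    simp only [pathIntegral, hder]
    rw [harc, intervalIntegral.integral_mul_const]
    have := intervalIntegral.integral_comp_mul_add (a := 0) (b := 1) g
      (c := 2 * k) (by positivity) (-k)
    have e : ∀ s : ℝ, (2 * s - 1) * k = 2 * k * s + -k := fun s => by ring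
    simp only [e]
    change (∫ s in (0 : ℝ)..1, g (2 * k * s + -k)) * (2 * k) = _
    rw [this, smul_eq_mul]
    have e1 : 2 * k * 0 + -k = -k := by ring
    have e2 : 2 * k * 1 + -k = k := by ring
    rw [e1, e2]
    field_simp
  rw [h4, ← intervalIntegral.integral_add_adjacent_intervals
    (hgc.intervalIntegrable (-k) 0) (hgc.intervalIntegrable 0 k)]
  have h5 : ∫ φ in (-k)..0, g φ = ∫ φ in (0 : ℝ)..k, g (-φ) := by
    rw [intervalIntegral.integral_comp_neg]; simp
  have hgn : Continuous fun φ => g (-φ) := by fun_prop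
  rw [h5, ← intervalIntegral.integral_add (hgn.intervalIntegrable 0 k)
    (hgc.intervalIntegrable 0 k)]
  refine intervalIntegral.integral_congr fun φ _ => ?_
  simp only [hg, Real.cos_neg, Real.sin_neg, neg_smul, ← sub_eq_add_neg]
  ring

end Arc

/-! ### Means over the sphere -/

section Sphere

open Metric Set
open scoped Pointwise

variable {d : ℕ}

/-- Linear isometries preserve the surface measure: it is a multiple of the volume of the cone
over a set, and they carry cones to cones. -/
theorem measurePreserving_sphere (σ : EuclideanSpace ℝ (Fin (d + 1)) ≃ₗᵢ[ℝ]
    EuclideanSpace ℝ (Fin (d + 1))) :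
    MeasurePreserving (fun u : sphere (0 : EuclideanSpace ℝ (Fin (d + 1))) 1 =>
      (⟨σ u, by simp⟩ : sphere (0 : EuclideanSpace ℝ (Fin (d + 1))) 1))
      (volume : Measure (EuclideanSpace ℝ (Fin (d + 1)))).toSphere
      (volume : Measure (EuclideanSpace ℝ (Fin (d + 1)))).toSphere := by
  have hc : Continuous (fun u : sphere (0 : EuclideanSpace ℝ (Fin (d + 1))) 1 =>
      (⟨σ u, by simp⟩ : sphere (0 : EuclideanSpace ℝ (Fin (d + 1))) 1)) := by fun_prop
  refine ⟨hc.measurable, ?_⟩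
  ext s hs
  rw [Measure.map_apply hc.measurable hs, Measure.toSphere_apply' _ (hc.measurable hs),
    Measure.toSphere_apply' _ hs]
  congr 1
  rw [← σ.measurePreserving.measure_preimage_emb σ.toMeasurableEquiv.measurableEmbedding
    (Ioo (0 : ℝ) 1 • (Subtype.val '' s))]
  congr 1
  ext v
  simp only [Set.mem_smul, mem_image, Set.mem_preimage, Subtype.exists]
  constructor
  · rintro ⟨r, hr, _, ⟨u, hu, hus, rfl⟩, rfl⟩
    exact ⟨r, hr, σ u, ⟨σ u, by simpa using hu, hus, rfl⟩, by simp⟩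
  · rintro ⟨r, hr, _, ⟨u, hu, hus, rfl⟩, hv⟩
    refine ⟨r, hr, σ.symm u, ⟨σ.symm u, by simpa using hu, ?_, rfl⟩, ?_⟩
    · simpa using hus
    · rw [← map_smul, hv]; simp

theorem sphereIntegral_comp (σ : EuclideanSpace ℝ (Fin (d + 1)) ≃ₗᵢ[ℝ]
    EuclideanSpace ℝ (Fin (d + 1))) {f : EuclideanSpace ℝ (Fin (d + 1)) → ℝ} (hf : Continuous f) :
    sphereIntegral (fun y => f (σ y)) = sphereIntegral f := by
  have h := measurePreserving_sphere σ
  have hc : Continuous fun u : sphere (0 : EuclideanSpace ℝ (Fin (d + 1))) 1 => f u := by fun_prop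
  simp only [sphereIntegral, average_eq]
  congr 1
  rw [← integral_map h.measurable.aemeasurable
    (f := fun u : sphere (0 : EuclideanSpace ℝ (Fin (d + 1))) 1 => f u)
    hc.aestronglyMeasurable, h.map_eq]

/-- The linear isometry `y ↦ (e 0 * y (p 0), …, e d * y (p d))` for signs `e` and a permutation `p`
of the coordinates. -/
noncomputable def signedPerm (e : Fin (d + 1) → ℝ) (he : ∀ i, e i ^ 2 = 1)
    (p : Equiv.Perm (Fin (d + 1))) :
    EuclideanSpace ℝ (Fin (d + 1)) ≃ₗᵢ[ℝ] EuclideanSpace ℝ (Fin (d + 1)) :=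
  LinearIsometry.toLinearIsometryEquiv
    { toFun := fun y => WithLp.toLp 2 fun i => e i * y (p i)
      map_add' := fun y z => by ext i; simp [mul_add]
      map_smul' := fun r y => by ext i; simp; ring
      norm_map' := fun y => by
        simp only [LinearMap.coe_mk, AddHom.coe_mk, EuclideanSpace.norm_eq, Real.norm_eq_abs,
          sq_abs, mul_pow, he, one_mul]
        rw [Equiv.sum_comp p fun i => y i ^ 2] } rfl

theorem signedPerm_apply (e : Fin (d + 1) → ℝ) (he : ∀ i, e i ^ 2 = 1)
    (p : Equiv.Perm (Fin (d + 1))) (y : EuclideanSpace ℝ (Fin (d + 1))) :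
    signedPerm e he p y = WithLp.toLp 2 fun i => e i * y (p i) := rfl

theorem sphereIntegral_add {f g : EuclideanSpace ℝ (Fin (d + 1)) → ℝ} (hf : Continuous f)
    (hg : Continuous g) :
    sphereIntegral (fun y => f y + g y) = sphereIntegral f + sphereIntegral g := by
  have h : ∀ {f : EuclideanSpace ℝ (Fin (d + 1)) → ℝ}, Continuous f →
      Integrable (fun u : sphere (0 : EuclideanSpace ℝ (Fin (d + 1))) 1 => f u)
        (volume : Measure (EuclideanSpace ℝ (Fin (d + 1)))).toSphere := fun {f} hf => by
    have : Continuous fun u : sphere (0 : EuclideanSpace ℝ (Fin (d + 1))) 1 => f u := by fun_prop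
    exact this.integrable_of_hasCompactSupport (HasCompactSupport.of_compactSpace _)
  simp only [sphereIntegral, average_eq]
  rw [integral_add (h hf) (h hg), smul_add]

theorem sphereIntegral_const_mul (r : ℝ) (f : EuclideanSpace ℝ (Fin (d + 1)) → ℝ) :
    sphereIntegral (fun y => r * f y) = r * sphereIntegral f := by
  simp only [sphereIntegral, average_eq, integral_const_mul, smul_eq_mul]
  ring

theorem sphereIntegral_const (r : ℝ) :
    sphereIntegral (fun _ : EuclideanSpace ℝ (Fin (d + 1)) => r) = r := by
  have : NeZero ((volume : Measure (EuclideanSpace ℝ (Fin (d + 1)))).toSphere) :=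
    ⟨Measure.toSphere_ne_zero _⟩
  simp only [sphereIntegral, average_const]

theorem sphereIntegral_congr {f g : EuclideanSpace ℝ (Fin (d + 1)) → ℝ}
    (h : ∀ y, ‖y‖ = 1 → f y = g y) : sphereIntegral f = sphereIntegral g := by
  simp only [sphereIntegral]
  congr 1
  ext u
  exact h u (by simp)

/-- All coordinates have the same second moment by symmetry, and the second moments sum to one. -/
theorem sphereIntegral_sq_coord (i : Fin (d + 1)) :
    sphereIntegral (fun y : EuclideanSpace ℝ (Fin (d + 1)) => y i ^ 2) = 1 / (d + 1) := by
  have hsum : ∀ s : Finset (Fin (d + 1)),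
      sphereIntegral (fun y : EuclideanSpace ℝ (Fin (d + 1)) => ∑ j ∈ s, y j ^ 2) =
        ∑ j ∈ s, sphereIntegral (fun y : EuclideanSpace ℝ (Fin (d + 1)) => y j ^ 2) := by
    intro s
    induction s using Finset.induction_on with
    | empty => simpa using sphereIntegral_const (d := d) 0
    | insert j s hj ih =>
      simp only [Finset.sum_insert hj]
      rw [sphereIntegral_add (by fun_prop) (by fun_prop), ih]
  have hperm : ∀ j, sphereIntegral (fun y : EuclideanSpace ℝ (Fin (d + 1)) => y j ^ 2) =
      sphereIntegral (fun y : EuclideanSpace ℝ (Fin (d + 1)) => y i ^ 2) := by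
    intro j
    rw [← sphereIntegral_comp (signedPerm 1 (by simp) (Equiv.swap i j))
      (f := fun y => y i ^ 2) (by fun_prop)]
    simp [signedPerm_apply]
  have h1 : sphereIntegral (fun y : EuclideanSpace ℝ (Fin (d + 1)) => ∑ j, y j ^ 2) = 1 := by
    rw [sphereIntegral_congr (g := fun _ => 1), sphereIntegral_const]
    intro y hy
    rw [← EuclideanSpace.real_norm_sq_eq, hy, one_pow]
  rw [hsum, Finset.sum_congr rfl fun j _ => hperm j] at h1
  simp only [Finset.sum_const, Finset.card_univ, Fintype.card_fin, nsmul_eq_mul] at h1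
  push_cast at h1
  rw [eq_div_iff (by positivity)]
  linarith

end Sphere

/-! ### Averaging over the symmetry group of the control points -/

section Symmetrization

/-- The sum of `f` over the orbit of `(x, y, z)` under the symmetry group of the control points:
the group of order eight generated by the sign changes of the first two coordinates and by
`(x, y, z) ↦ (y, x, -z)`. Orbits are counted with multiplicity. -/
def orbitSum (f : EuclideanSpace ℝ (Fin (2 + 1)) → ℝ) (x y z : ℝ) : ℝ :=
  f !₂[x, y, z] + f !₂[-x, y, z] + f !₂[x, -y, z] + f !₂[-x, -y, z] +
    f !₂[y, x, -z] + f !₂[-y, x, -z] + f !₂[y, -x, -z] + f !₂[-y, -x, -z]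

/-- The invariants of degree at most three are spanned by `1`, `x ^ 2 + y ^ 2`, `z ^ 2` and
`z * (x ^ 2 - y ^ 2)`; on the unit sphere the second one is `1 - z ^ 2`. -/
theorem exists_orbitSum_monomial {i j k : ℕ} (h : i + j + k ≤ 3) :
    ∃ a b c : ℝ, ∀ x y z : ℝ, x ^ 2 + y ^ 2 + z ^ 2 = 1 →
      orbitSum (fun v => v 0 ^ i * v 1 ^ j * v 2 ^ k) x y z =
        a + b * z ^ 2 + c * (z * (x ^ 2 - y ^ 2)) := by
  simp only [orbitSum, Matrix.cons_val]
  -- An odd exponent of `x` or `y`, or a pure odd power of `z`, cancels in the orbit sum.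
  have odd : (Odd i ∨ Odd j) ∨ (i = 0 ∧ j = 0 ∧ Odd k) ∨ (i = 0 ∧ j = 0 ∧ k = 0) ∨
      (i = 0 ∧ j = 0 ∧ k = 2) ∨ (i = 2 ∧ j = 0 ∧ k = 0) ∨ (i = 2 ∧ j = 0 ∧ k = 1) ∨
      (i = 0 ∧ j = 2 ∧ k = 0) ∨ (i = 0 ∧ j = 2 ∧ k = 1) := by
    have hi : i ≤ 3 := by omega
    have hj : j ≤ 3 := by omega
    have hk : k ≤ 3 := by omega
    interval_cases i <;> interval_cases j <;> interval_cases k <;> first | omega | decide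
  rcases odd with (hi | hj) | ⟨rfl, rfl, hk⟩ | ⟨rfl, rfl, rfl⟩ | ⟨rfl, rfl, rfl⟩ |
      ⟨rfl, rfl, rfl⟩ | ⟨rfl, rfl, rfl⟩ | ⟨rfl, rfl, rfl⟩ | ⟨rfl, rfl, rfl⟩
  · exact ⟨0, 0, 0, fun x y z _ => by simp only [hi.neg_pow]; ring⟩
  · exact ⟨0, 0, 0, fun x y z _ => by simp only [hj.neg_pow]; ring⟩
  · exact ⟨0, 0, 0, fun x y z _ => by simp only [hk.neg_pow]; ring⟩
  · exact ⟨8, 0, 0, fun x y z _ => by ring⟩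
  · exact ⟨0, 8, 0, fun x y z _ => by ring⟩
  · exact ⟨4, -4, 0, fun x y z h => by linear_combination 4 * h⟩
  · exact ⟨0, 0, 4, fun x y z _ => by ring⟩
  · exact ⟨4, -4, 0, fun x y z h => by linear_combination 4 * h⟩
  · exact ⟨0, 0, -4, fun x y z _ => by ring⟩

theorem exists_orbitSum_eval {p : MvPolynomial (Fin (2 + 1)) ℝ} (hp : p.totalDegree ≤ 3) :
    ∃ a b c : ℝ, ∀ x y z : ℝ, x ^ 2 + y ^ 2 + z ^ 2 = 1 →
      orbitSum (fun v => MvPolynomial.eval (fun i => v i) p) x y z =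
        a + b * z ^ 2 + c * (z * (x ^ 2 - y ^ 2)) := by
  have hmon : ∀ d ∈ p.support, ∃ a b c : ℝ, ∀ x y z : ℝ, x ^ 2 + y ^ 2 + z ^ 2 = 1 →
      orbitSum (fun v => v 0 ^ d 0 * v 1 ^ d 1 * v 2 ^ d 2) x y z =
        a + b * z ^ 2 + c * (z * (x ^ 2 - y ^ 2)) := fun d hd => by
    refine exists_orbitSum_monomial ?_
    have := (MvPolynomial.le_totalDegree hd).trans hp
    rw [Finsupp.sum_fintype _ _ (fun _ => rfl)] at this
    simpa [Fin.sum_univ_three] using this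
  choose! a b c habc using hmon
  refine ⟨∑ d ∈ p.support, p.coeff d * a d, ∑ d ∈ p.support, p.coeff d * b d,
    ∑ d ∈ p.support, p.coeff d * c d, fun x y z h => ?_⟩
  have heval : ∀ v : Fin (2 + 1) → ℝ, MvPolynomial.eval v p =
      ∑ d ∈ p.support, p.coeff d * (v 0 ^ d 0 * v 1 ^ d 1 * v 2 ^ d 2) := fun v => by
    rw [MvPolynomial.eval_eq']
    exact Finset.sum_congr rfl fun d _ => congrArg _ (Fin.prod_univ_three _)
  simp only [orbitSum, heval, Finset.sum_mul, ← Finset.sum_add_distrib]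
  refine Finset.sum_congr rfl fun d hd => ?_
  have := habc d hd x y z h
  simp only [orbitSum] at this
  linear_combination p.coeff d * this

theorem sphereIntegral_eq_orbitSum {f : EuclideanSpace ℝ (Fin (2 + 1)) → ℝ} (hf : Continuous f) :
    sphereIntegral f = 1 / 8 * sphereIntegral fun v : EuclideanSpace ℝ (Fin (2 + 1)) =>
      orbitSum f (v 0) (v 1) (v 2) := by
  have key : ∀ (e : Fin (2 + 1) → ℝ) (he : ∀ i, e i ^ 2 = 1) (p : Equiv.Perm (Fin (2 + 1))),
      sphereIntegral (fun v => f !₂[e 0 * v (p 0), e 1 * v (p 1), e 2 * v (p 2)]) =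
        sphereIntegral f := fun e he p => by
    rw [← sphereIntegral_comp (signedPerm e he p) hf]
    congr 1
    ext v
    congr 1
    ext i
    fin_cases i <;> simp [signedPerm_apply]
  have h1 := key ![1, 1, 1] (by simp [Fin.forall_fin_succ]) 1
  have h2 := key ![-1, 1, 1] (by simp [Fin.forall_fin_succ]) 1
  have h3 := key ![1, -1, 1] (by simp [Fin.forall_fin_succ]) 1
  have h4 := key ![-1, -1, 1] (by simp [Fin.forall_fin_succ]) 1
  have h5 := key ![1, 1, -1] (by simp [Fin.forall_fin_succ]) (Equiv.swap 0 1)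
  have h6 := key ![-1, 1, -1] (by simp [Fin.forall_fin_succ]) (Equiv.swap 0 1)
  have h7 := key ![1, -1, -1] (by simp [Fin.forall_fin_succ]) (Equiv.swap 0 1)
  have h8 := key ![-1, -1, -1] (by simp [Fin.forall_fin_succ]) (Equiv.swap 0 1)
  have hswap : Equiv.swap (0 : Fin (2 + 1)) 1 2 = 2 := by decide
  simp only [Matrix.cons_val, one_mul, neg_one_mul, Equiv.Perm.one_apply, Equiv.swap_apply_left,
    Equiv.swap_apply_right, hswap] at h1 h2 h3 h4 h5 h6 h7 h8
  simp only [orbitSum]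
  repeat rw [sphereIntegral_add (by fun_prop) (by fun_prop)]
  rw [h1, h2, h3, h4, h5, h6, h7, h8]
  ring

theorem sphereIntegral_of_orbitSum {f : EuclideanSpace ℝ (Fin (2 + 1)) → ℝ} (hf : Continuous f)
    {a b c : ℝ} (h : ∀ x y z : ℝ, x ^ 2 + y ^ 2 + z ^ 2 = 1 →
      orbitSum f x y z = a + b * z ^ 2 + c * (z * (x ^ 2 - y ^ 2))) :
    sphereIntegral f = (a + b / 3) / 8 := by
  have hodd : sphereIntegral
      (fun v : EuclideanSpace ℝ (Fin (2 + 1)) => v 2 * (v 0 ^ 2 - v 1 ^ 2)) = 0 := by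
    have := sphereIntegral_comp (signedPerm (d := 2) ![1, 1, -1] (by simp [Fin.forall_fin_succ]) 1)
      (f := fun v => v 2 * (v 0 ^ 2 - v 1 ^ 2)) (by fun_prop)
    simp only [signedPerm_apply, PiLp.toLp_apply, Matrix.cons_val, one_mul,
      Equiv.Perm.one_apply, mul_assoc] at this
    rw [sphereIntegral_const_mul] at this
    linarith
  rw [sphereIntegral_eq_orbitSum hf, sphereIntegral_congr (g := fun v => a + b * v 2 ^ 2 +
    c * (v 2 * (v 0 ^ 2 - v 1 ^ 2))), sphereIntegral_add (by fun_prop) (by fun_prop),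
    sphereIntegral_add (by fun_prop) (by fun_prop), sphereIntegral_const, sphereIntegral_const_mul,
    sphereIntegral_const_mul, hodd, sphereIntegral_sq_coord]
  · push_cast; ring
  · intro y hy
    refine h _ _ _ ?_
    have := EuclideanSpace.real_norm_sq_eq y
    rw [hy, Fin.sum_univ_three] at this
    linarith

end Symmetrization

/-! ### Solving the two moment equations -/

section Existence

open Set

/-- A two-dimensional intermediate value theorem: `G` is strictly increasing in `a` and changes
sign from `a₁` to `a₂`, and on the zero set of `G` the function `F` changes sign from `b₁` to
`b₂`. The zero set is a graph over the interval of the `b`, so connectedness of that interval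
suffices. -/
theorem exists_common_zero {G F : ℝ → ℝ → ℝ} {a₁ a₂ b₁ b₂ : ℝ} (ha : a₁ ≤ a₂) (hb : b₁ ≤ b₂)
    (hG : ContinuousOn (fun p : ℝ × ℝ => G p.1 p.2) (Icc a₁ a₂ ×ˢ Icc b₁ b₂))
    (hF : ContinuousOn (fun p : ℝ × ℝ => F p.1 p.2) (Icc a₁ a₂ ×ˢ Icc b₁ b₂))
    (hmono : ∀ b ∈ Icc b₁ b₂, StrictMonoOn (fun a => G a b) (Icc a₁ a₂))
    (hG₁ : ∀ b ∈ Icc b₁ b₂, G a₁ b ≤ 0) (hG₂ : ∀ b ∈ Icc b₁ b₂, 0 ≤ G a₂ b)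
    (hF₁ : ∀ a ∈ Icc a₁ a₂, G a b₁ = 0 → 0 ≤ F a b₁)
    (hF₂ : ∀ a ∈ Icc a₁ a₂, G a b₂ = 0 → F a b₂ ≤ 0) :
    ∃ a ∈ Icc a₁ a₂, ∃ b ∈ Icc b₁ b₂, G a b = 0 ∧ F a b = 0 := by
  set R := Icc a₁ a₂ ×ˢ Icc b₁ b₂ with hR
  have hRc : IsCompact R := isCompact_Icc.prod isCompact_Icc
  have hroot : ∀ b ∈ Icc b₁ b₂, ∃ a ∈ Icc a₁ a₂, G a b = 0 := fun b hb' => by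
    have hc : ContinuousOn (fun a => G a b) (Icc a₁ a₂) :=
      hG.comp (f := fun a => (a, b)) (by fun_prop) fun a ha' => ⟨ha', hb'⟩
    exact intermediate_value_Icc ha hc ⟨hG₁ b hb', hG₂ b hb'⟩
  -- The points `b` over which `F` is nonnegative (nonpositive) on the zero set form a closed set.
  have hclosed : ∀ T : Set (ℝ × ℝ), IsClosed T →
      IsClosed (Prod.snd '' (R ∩ (fun p : ℝ × ℝ => (G p.1 p.2, F p.1 p.2)) ⁻¹' T)) := fun T hT => by
    have h := (hG.prodMk hF).preimage_isClosed_of_isClosed hRc.isClosed hT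
    exact ((hRc.of_isClosed_subset h inter_subset_left).image continuous_snd).isClosed
  have hU := hclosed ({0} ×ˢ Ici 0) (isClosed_singleton.prod isClosed_Ici)
  have hV := hclosed ({0} ×ˢ Iic 0) (isClosed_singleton.prod isClosed_Iic)
  obtain ⟨b, hb', ⟨⟨a, _⟩, ⟨haR, hGa, hFa⟩, rfl⟩, ⟨⟨a', b⟩, ⟨haR', hGa', hFa'⟩, h⟩⟩ :=
    isPreconnected_closed_iff.1 (isPreconnected_Icc (a := b₁) (b := b₂)) _ _ hU hV
      (fun b hb' => by
        obtain ⟨a, ha', hGa⟩ := hroot b hb'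
        rcases le_total 0 (F a b) with h | h
        · exact Or.inl ⟨(a, b), ⟨⟨ha', hb'⟩, hGa, h⟩, rfl⟩
        · exact Or.inr ⟨(a, b), ⟨⟨ha', hb'⟩, hGa, h⟩, rfl⟩)
      (by
        obtain ⟨a, ha', hGa⟩ := hroot b₁ (left_mem_Icc.2 hb)
        exact ⟨b₁, left_mem_Icc.2 hb, (a, b₁),
          ⟨⟨ha', left_mem_Icc.2 hb⟩, hGa, hF₁ a ha' hGa⟩, rfl⟩)
      (by
        obtain ⟨a, ha', hGa⟩ := hroot b₂ (right_mem_Icc.2 hb)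
        exact ⟨b₂, right_mem_Icc.2 hb, (a, b₂),
          ⟨⟨ha', right_mem_Icc.2 hb⟩, hGa, hF₂ a ha' hGa⟩, rfl⟩)
  simp only at h hb' hGa hFa hGa' hFa'
  subst h
  have haa : a = a' := (hmono b hb').injOn haR.1 haR'.1
    ((mem_singleton_iff.1 hGa).trans (mem_singleton_iff.1 hGa').symm)
  subst haa
  exact ⟨a, haR.1, b, hb', hGa, le_antisymm hFa' hFa⟩

/-- A positive multiple of the integral of `z * (x ^ 2 - y ^ 2)` over the cycle with parameters
`α`, `β`. -/
noncomputable def oddMoment (α β : ℝ) : ℝ :=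
  β * (α ^ 2 * (3 - β ^ 2) - β ^ 2 * (1 - β ^ 2)) -
    (β - α) * Real.sqrt (1 - β ^ 2) ^ 3 * Real.sqrt (2 - (α + β) ^ 2)

/-- One quarter of the integral of `z ^ 2 - 1 / 3` over the cycle with parameters `α`, `β`. The
half-angles of the arcs are `arcsin β` (for those that stay on one side of the equator) and
`arccos ((α + β) / √2)` (for those crossing the equator). -/
noncomputable def evenMoment (α β : ℝ) : ℝ :=
  (1 - α ^ 2 - β ^ 2) / (1 - β ^ 2) * (Real.arcsin β + β * Real.sqrt (1 - β ^ 2)) +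
    (1 - α ^ 2 - β ^ 2) / (1 - ((α + β) / √2) ^ 2) *
      (Real.arccos ((α + β) / √2) - (α + β) / √2 * √(1 - ((α + β) / √2) ^ 2)) -
    2 / 3 * (Real.arcsin β + Real.arccos ((α + β) / √2))

theorem div_sqrt_two_sq (x : ℝ) : (x / √2) ^ 2 = x ^ 2 / 2 := by
  rw [div_pow, Real.sq_sqrt (by norm_num)]

theorem strictMonoOn_oddMoment {β : ℝ} (hβ : β ∈ Icc (3 / 5 : ℝ) (15 / 17)) :
    StrictMonoOn (fun α => oddMoment α β) (Icc (1 / 4) (2 / 5)) := by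
  intro a ha b hb hab
  obtain ⟨h1, h2⟩ := hβ
  obtain ⟨h3, h4⟩ := ha
  obtain ⟨h5, h6⟩ := hb
  have hs : √(2 - (b + β) ^ 2) ≤ √(2 - (a + β) ^ 2) := Real.sqrt_le_sqrt (by nlinarith)
  have hc : 0 ≤ √(1 - β ^ 2) ^ 3 := by positivity
  have h7 : (β - b) * √(1 - β ^ 2) ^ 3 * √(2 - (b + β) ^ 2) ≤
      (β - a) * √(1 - β ^ 2) ^ 3 * √(2 - (a + β) ^ 2) := by
    have : 0 ≤ β - b := by linarith
    have : 0 ≤ β - a := by linarith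
    gcongr
  have h8 : β * (a ^ 2 * (3 - β ^ 2) - β ^ 2 * (1 - β ^ 2)) <
      β * (b ^ 2 * (3 - β ^ 2) - β ^ 2 * (1 - β ^ 2)) := by
    have : 0 < β := by linarith
    have : 0 < 3 - β ^ 2 := by nlinarith
    have : 0 ≤ a := by linarith
    gcongr
  simp only [oddMoment]
  linarith

theorem oddMoment_quarter_nonpos {β : ℝ} (hβ : β ∈ Icc (3 / 5 : ℝ) (15 / 17)) :
    oddMoment (1 / 4) β ≤ 0 := by
  obtain ⟨h1, h2⟩ := hβ
  have h3 : 0 ≤ (β - 1 / 4) * √(1 - β ^ 2) ^ 3 * √(2 - (1 / 4 + β) ^ 2) := by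
    have : 0 ≤ β - 1 / 4 := by linarith
    positivity
  have h4 : (1 / 4) ^ 2 * (3 - β ^ 2) - β ^ 2 * (1 - β ^ 2) ≤ 0 := by
    have h5 : (9 / 25 : ℝ) ≤ β ^ 2 := by nlinarith
    have h6 : β ^ 2 ≤ (225 / 289 : ℝ) := by nlinarith
    nlinarith [mul_nonneg (sub_nonneg.2 h5) (sub_nonneg.2 h6)]
  rw [oddMoment]
  nlinarith

/-- The product of the two square roots is bounded by the inequality of arithmetic and geometric
means, which leaves a polynomial of degree five in `β`. -/
theorem oddMoment_two_fifths_nonneg {β : ℝ} (hβ : β ∈ Icc (3 / 5 : ℝ) (15 / 17)) :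
    0 ≤ oddMoment (2 / 5) β := by
  obtain ⟨h1, h2⟩ := hβ
  have hu : 0 ≤ 1 - β ^ 2 := by nlinarith
  have hw : 0 ≤ 2 - (2 / 5 + β) ^ 2 := by nlinarith
  have hsu := Real.sq_sqrt hu
  have hsw := Real.sq_sqrt hw
  set u := √(1 - β ^ 2)
  set w := √(2 - (2 / 5 + β) ^ 2)
  -- The ratio `w / u` stays close to `5 / 4` on the whole interval, so this loses very little.
  have huw : u * w ≤ 5 / 8 * (1 - β ^ 2) + 2 / 5 * (2 - (2 / 5 + β) ^ 2) := by
    nlinarith [sq_nonneg (5 * u - 4 * w)]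
  have h3 : (β - 2 / 5) * u ^ 3 * w ≤ (β - 2 / 5) * (1 - β ^ 2) *
      (5 / 8 * (1 - β ^ 2) + 2 / 5 * (2 - (2 / 5 + β) ^ 2)) := by
    have : 0 ≤ β - 2 / 5 := by linarith
    calc (β - 2 / 5) * u ^ 3 * w = (β - 2 / 5) * (1 - β ^ 2) * (u * w) := by rw [← hsu]; ring
      _ ≤ _ := by gcongr
  rw [oddMoment]
  refine sub_nonneg.2 (h3.trans ?_)
  -- The difference has nonnegative coefficients in the Bernstein basis of degree eight.
  have hl : 0 ≤ β - 3 / 5 := by linarith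
  have hr : 0 ≤ 15 / 17 - β := by linarith
  have hb : ∀ i j : ℕ, 0 ≤ (β - 3 / 5) ^ i * (15 / 17 - β) ^ j := fun i j => by positivity
  linarith [hb 0 8, hb 1 7, hb 2 6, hb 3 5, hb 4 4, hb 5 3, hb 6 2, hb 7 1, hb 8 0]

theorem oddMoment_neg {α : ℝ} (h0 : 0 ≤ α) (hα : α ≤ 3 / 10) : oddMoment α (15 / 17) < 0 := by
  have e : √(1 - (15 / 17 : ℝ) ^ 2) = 8 / 17 := by
    rw [Real.sqrt_eq_iff_mul_self_eq] <;> norm_num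
  have hw : (3 / 4 : ℝ) ≤ √(2 - (α + 15 / 17) ^ 2) := Real.le_sqrt_of_sq_le (by nlinarith)
  rw [oddMoment, e]
  nlinarith

/-- The angles are bounded below by their sines; their coefficients are nonnegative here. -/
theorem evenMoment_nonneg {α : ℝ} (hα : α ∈ Icc (1 / 4 : ℝ) (2 / 5)) :
    0 ≤ evenMoment α (3 / 5) := by
  obtain ⟨h1, h2⟩ := hα
  have e : √(1 - (3 / 5 : ℝ) ^ 2) = 4 / 5 := by
    rw [Real.sqrt_eq_iff_mul_self_eq] <;> norm_num
  have hC2 := div_sqrt_two_sq (α + 3 / 5)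
  have hC0 : 0 ≤ (α + 3 / 5) / √2 := by positivity
  have hSC := Real.sin_arccos ((α + 3 / 5) / √2)
  have hk := Real.sin_le (Real.arccos_nonneg ((α + 3 / 5) / √2))
  have hh := Real.sin_le (Real.arcsin_nonneg.2 (by norm_num : (0 : ℝ) ≤ 3 / 5))
  rw [Real.sin_arcsin (by norm_num) (by norm_num)] at hh
  rw [hSC] at hk
  rw [evenMoment, e]
  set C := (α + 3 / 5) / √2
  set k := Real.arccos C
  set h := Real.arcsin (3 / 5)
  have hS2 : √(1 - C ^ 2) ^ 2 = 1 - C ^ 2 := Real.sq_sqrt (by nlinarith)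
  have hS0 : 0 ≤ √(1 - C ^ 2) := Real.sqrt_nonneg _
  have hS : (7 / 10 : ℝ) ≤ √(1 - C ^ 2) := Real.le_sqrt_of_sq_le (by nlinarith)
  have hpos : 0 < 1 - C ^ 2 := by nlinarith
  set S := √(1 - C ^ 2)
  have hCS : C * S ≤ 1 / 2 := by nlinarith [sq_nonneg (C - S)]
  have hC1 : C ≤ 1 := by nlinarith
  have hr1 : (3 / 4 : ℝ) ≤ (1 - α ^ 2 - (3 / 5) ^ 2) / (1 - (3 / 5) ^ 2) := by
    rw [le_div_iff₀ (by norm_num)]; nlinarith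
  have hr2 : (9 / 10 : ℝ) ≤ (1 - α ^ 2 - (3 / 5) ^ 2) / (1 - C ^ 2) := by
    rw [le_div_iff₀ hpos]; nlinarith
  have hkCS : 0 ≤ k - C * S := by nlinarith
  have t1 := mul_le_mul_of_nonneg_right hr1 (by linarith : 0 ≤ h + 3 / 5 * (4 / 5))
  have t2 := mul_le_mul_of_nonneg_right hr2 hkCS
  linarith

/-- Both fractions are small enough that the angles enter with nonpositive coefficients, so again it
suffices to bound them below, by `15 / 17` and by `C * S`. -/
theorem evenMoment_nonpos {α : ℝ} (hα : α ∈ Icc (3 / 10 : ℝ) (2 / 5)) :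
    evenMoment α (15 / 17) ≤ 0 := by
  obtain ⟨h1, h2⟩ := hα
  have e : √(1 - (15 / 17 : ℝ) ^ 2) = 8 / 17 := by
    rw [Real.sqrt_eq_iff_mul_self_eq] <;> norm_num
  have hC2 := div_sqrt_two_sq (α + 15 / 17)
  have hC0 : 0 ≤ (α + 15 / 17) / √2 := by positivity
  have hSC := Real.sin_arccos ((α + 15 / 17) / √2)
  have hk := Real.sin_le (Real.arccos_nonneg ((α + 15 / 17) / √2))
  have hh := Real.sin_le (Real.arcsin_nonneg.2 (by norm_num : (0 : ℝ) ≤ 15 / 17))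
  rw [Real.sin_arcsin (by norm_num) (by norm_num)] at hh
  rw [hSC] at hk
  rw [evenMoment, e]
  set C := (α + 15 / 17) / √2
  set k := Real.arccos C
  set h := Real.arcsin (15 / 17)
  have hlo : (69 / 100 : ℝ) ≤ C ^ 2 := by nlinarith
  have hhi : C ^ 2 ≤ 83 / 100 := by nlinarith
  have hpos : 0 < 1 - C ^ 2 := by linarith
  have hS2 : √(1 - C ^ 2) ^ 2 = 1 - C ^ 2 := Real.sq_sqrt hpos.le
  have hS0 : 0 ≤ √(1 - C ^ 2) := Real.sqrt_nonneg _
  set S := √(1 - C ^ 2)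
  have hC1 : C ≤ 1 := by nlinarith
  have hkCS : C * S ≤ k := by nlinarith
  have hCS : 1 / 3 ≤ C * S := by
    refine abs_le_of_sq_le_sq' ?_ (by positivity) |>.2
    rw [mul_pow, hS2]
    nlinarith [mul_nonneg (sub_nonneg.2 hlo) (sub_nonneg.2 hhi)]
  have hr1 : (1 - α ^ 2 - (15 / 17) ^ 2) / (1 - (15 / 17) ^ 2) ≤ (3 / 5 : ℝ) := by
    rw [div_le_iff₀ (by norm_num)]; nlinarith
  have hr2 : (1 - α ^ 2 - (15 / 17) ^ 2) / (1 - C ^ 2) ≤ 2 / 3 := by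
    rw [div_le_iff₀ hpos]; nlinarith
  have t1 := mul_le_mul_of_nonneg_right hr1 (by linarith : 0 ≤ h + 15 / 17 * (8 / 17))
  have t2 := mul_le_mul_of_nonneg_right hr2 (sub_nonneg.2 hkCS)
  linarith

theorem exists_moments_eq_zero : ∃ α ∈ Icc (1 / 4 : ℝ) (2 / 5), ∃ β ∈ Icc (3 / 5 : ℝ) (15 / 17),
    oddMoment α β = 0 ∧ evenMoment α β = 0 := by
  refine exists_common_zero (by norm_num) (by norm_num) ?_ ?_ (fun b => strictMonoOn_oddMoment)
    (fun b => oddMoment_quarter_nonpos) (fun b => oddMoment_two_fifths_nonneg)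
    (fun a ha _ => evenMoment_nonneg ha) (fun a ha h => ?_)
  · unfold oddMoment
    fun_prop
  · unfold evenMoment
    have h1 : ∀ p ∈ Icc (1 / 4 : ℝ) (2 / 5) ×ˢ Icc (3 / 5 : ℝ) (15 / 17), 1 - p.2 ^ 2 ≠ 0 := by
      rintro ⟨a, b⟩ ⟨⟨ha, ha'⟩, hb, hb'⟩
      simp only at *
      nlinarith
    have h2 : ∀ p ∈ Icc (1 / 4 : ℝ) (2 / 5) ×ˢ Icc (3 / 5 : ℝ) (15 / 17),
        1 - ((p.1 + p.2) / √2) ^ 2 ≠ 0 := by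
      rintro ⟨a, b⟩ ⟨⟨ha, ha'⟩, hb, hb'⟩
      simp only [div_sqrt_two_sq] at *
      nlinarith
    have c1 : ContinuousOn (fun p : ℝ × ℝ => (1 - p.1 ^ 2 - p.2 ^ 2) / (1 - p.2 ^ 2))
      (Icc (1 / 4 : ℝ) (2 / 5) ×ˢ Icc (3 / 5 : ℝ) (15 / 17)) :=
      ContinuousOn.div (by fun_prop) (by fun_prop) h1
    have c2 : ContinuousOn (fun p : ℝ × ℝ =>
      (1 - p.1 ^ 2 - p.2 ^ 2) / (1 - ((p.1 + p.2) / √2) ^ 2))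
      (Icc (1 / 4 : ℝ) (2 / 5) ×ˢ Icc (3 / 5 : ℝ) (15 / 17)) :=
      ContinuousOn.div (by fun_prop) (by fun_prop) h2
    have c3 := Real.continuous_arcsin
    have c4 := Real.continuous_arccos
    fun_prop
  -- At `β = 15 / 17` the root of `oddMoment` lies to the right of `3 / 10`.
  · refine evenMoment_nonpos ⟨?_, ha.2⟩
    by_contra! hlt
    exact (oddMoment_neg (by linarith [ha.1]) hlt.le).ne h

end Existence

/-! ### Integrals over the cycle -/

section Cycle

open Real

theorem norm_vec_eq_one {x y z : ℝ} (h : x ^ 2 + y ^ 2 + z ^ 2 = 1) :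
    ‖(!₂[x, y, z] : EuclideanSpace ℝ (Fin (2 + 1)))‖ = 1 := by
  rw [EuclideanSpace.norm_eq, Real.sqrt_eq_one, ← h]
  exact (Fin.sum_univ_three _).trans (by simp)

theorem isControl_cubePoints {α β : ℝ} (hα : 0 < α) (hαβ : α < β) (h : α ^ 2 + β ^ 2 < 1) :
    IsControl (cubePoints α β) := by
  have hq : 0 < √(1 - α ^ 2 - β ^ 2) := Real.sqrt_pos.2 (by linarith)
  have hq2 : √(1 - α ^ 2 - β ^ 2) ^ 2 = 1 - α ^ 2 - β ^ 2 := Real.sq_sqrt (by linarith)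
  have hne : ∀ {x y z x' y' z' : ℝ}, (x = x' → y = y' → z = z' → False) →
      (!₂[x, y, z] : EuclideanSpace ℝ (Fin (2 + 1))) ≠ !₂[x', y', z'] := fun h e => by
    have := congrArg (fun v : EuclideanSpace ℝ (Fin (2 + 1)) => (v 0, v 1, v 2)) e
    simp only [Matrix.cons_val, Prod.mk.injEq] at this
    exact h this.1 this.2.1 this.2.2
  have hneg : ∀ {x y z : ℝ}, -(!₂[x, y, z] : EuclideanSpace ℝ (Fin (2 + 1))) =
      !₂[-x, -y, -z] := fun {x y z} => by
    ext i; fin_cases i <;> rfl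
  unfold cubePoints
  set q := √(1 - α ^ 2 - β ^ 2)
  constructor
  · intro j
    fin_cases j <;> exact norm_vec_eq_one (by nlinarith)
  · intro j
    fin_cases j <;> refine ⟨hne fun h1 h2 h3 => ?_, fun e => hne (fun h1 h2 h3 => ?_)
      (e.trans hneg)⟩ <;> linarith

theorem pathIntegral_arc_vec {k x y z x' y' z' m₀ m₁ m₂ w₀ w₁ w₂ : ℝ} (hk : 0 < k)
    (hk' : k < π / 2) (hm : m₀ ^ 2 + m₁ ^ 2 + m₂ ^ 2 = 1) (hw : w₀ ^ 2 + w₁ ^ 2 + w₂ ^ 2 = 1)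
    (hmw : m₀ * w₀ + m₁ * w₁ + m₂ * w₂ = 0)
    (hx : x = cos k * m₀ - sin k * w₀) (hy : y = cos k * m₁ - sin k * w₁)
    (hz : z = cos k * m₂ - sin k * w₂) (hx' : x' = cos k * m₀ + sin k * w₀)
    (hy' : y' = cos k * m₁ + sin k * w₁) (hz' : z' = cos k * m₂ + sin k * w₂)
    {f : EuclideanSpace ℝ (Fin (2 + 1)) → ℝ} (hf : Continuous f) :
    pathIntegral (arc (!₂[x, y, z] : EuclideanSpace ℝ (Fin (2 + 1))) !₂[x', y', z']) f =
      ∫ φ in (0 : ℝ)..k, (f !₂[cos φ * m₀ + sin φ * w₀, cos φ * m₁ + sin φ * w₁,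
          cos φ * m₂ + sin φ * w₂] +
        f !₂[cos φ * m₀ - sin φ * w₀, cos φ * m₁ - sin φ * w₁, cos φ * m₂ - sin φ * w₂]) := by
  have hadd : ∀ c s : ℝ, c • (!₂[m₀, m₁, m₂] : EuclideanSpace ℝ (Fin (2 + 1))) +
      s • !₂[w₀, w₁, w₂] = !₂[c * m₀ + s * w₀, c * m₁ + s * w₁, c * m₂ + s * w₂] := fun c s => by
    ext i; fin_cases i <;> rfl
  have hsub : ∀ c s : ℝ, c • (!₂[m₀, m₁, m₂] : EuclideanSpace ℝ (Fin (2 + 1))) -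
      s • !₂[w₀, w₁, w₂] = !₂[c * m₀ - s * w₀, c * m₁ - s * w₁, c * m₂ - s * w₂] := fun c s => by
    ext i; fin_cases i <;> rfl
  rw [pathIntegral_arc (norm_vec_eq_one hm) (norm_vec_eq_one hw) ?_ hk hk' ?_ ?_ hf]
  · simp only [hadd, hsub]
  · rw [PiLp.inner_apply]
    refine (Fin.sum_univ_three _).trans ?_
    simp only [Matrix.cons_val, RCLike.inner_apply, conj_trivial]
    linarith
  · rw [hsub, hx, hy, hz]
  · rw [hadd, hx', hy', hz']

/-- The cycle consists of two orbits of arcs. The arcs of half-angle `h` join two points of equal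
height; the midpoint of one of them is `(u, 0, v)`, with tangent `(0, 1, 0)`. The arcs of
half-angle `k` cross the equator; the midpoint of one of them is `(r, r, 0)`, with tangent
`(D, -D, -E)`. The folded halves of the four arcs of each kind are the eight images of one half arc. -/
theorem cycleIntegral_cubePoints {α β h k u v r D E : ℝ} (hh : 0 < h) (hh' : h < π / 2)
    (hk : 0 < k) (hk' : k < π / 2) (huv : u ^ 2 + v ^ 2 = 1) (hr : r ^ 2 = 1 / 2)
    (hDE : 2 * D ^ 2 + E ^ 2 = 1) (hα : α = cos h * u) (hβ : β = sin h)
    (hq : √(1 - α ^ 2 - β ^ 2) = cos h * v) (hα' : α = cos k * r - sin k * D)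
    (hβ' : β = cos k * r + sin k * D) (hq' : √(1 - α ^ 2 - β ^ 2) = sin k * E)
    {f : EuclideanSpace ℝ (Fin (2 + 1)) → ℝ} (hf : Continuous f) :
    cycleIntegral (cubePoints α β) f =
      (∫ φ in (0 : ℝ)..h, orbitSum f (u * cos φ) (sin φ) (v * cos φ)) +
      ∫ φ in (0 : ℝ)..k, orbitSum f (r * cos φ + D * sin φ) (r * cos φ - D * sin φ)
        (-(E * sin φ)) := by
  unfold cycleIntegral cubePoints
  set q := √(1 - α ^ 2 - β ^ 2)
  rw [Fin.sum_univ_eight]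
  have a0 := pathIntegral_arc_vec (x := α) (y := β) (z := q) (x' := β) (y' := α) (z' := -q)
    (m₀ := r) (m₁ := r) (m₂ := 0) (w₀ := D) (w₁ := -D) (w₂ := -E) hk hk' (by linarith)
    (by linarith) (by ring) (by linarith) (by linarith) (by linarith) (by linarith) (by linarith)
    (by linarith) hf
  have a1 := pathIntegral_arc_vec (x := β) (y := α) (z := -q) (x' := -β) (y' := α) (z' := -q)
    (m₀ := 0) (m₁ := u) (m₂ := -v) (w₀ := -1) (w₁ := 0) (w₂ := 0) hh hh' (by linarith)
    (by norm_num) (by ring) (by linarith) (by linarith) (by linarith) (by linarith) (by linarith)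
    (by linarith) hf
  have a2 := pathIntegral_arc_vec (x := -β) (y := α) (z := -q) (x' := -α) (y' := β) (z' := q)
    (m₀ := -r) (m₁ := r) (m₂ := 0) (w₀ := D) (w₁ := D) (w₂ := E) hk hk' (by linarith)
    (by linarith) (by ring) (by linarith) (by linarith) (by linarith) (by linarith) (by linarith)
    (by linarith) hf
  have a3 := pathIntegral_arc_vec (x := -α) (y := β) (z := q) (x' := -α) (y' := -β) (z' := q)
    (m₀ := -u) (m₁ := 0) (m₂ := v) (w₀ := 0) (w₁ := -1) (w₂ := 0) hh hh' (by linarith)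
    (by norm_num) (by ring) (by linarith) (by linarith) (by linarith) (by linarith) (by linarith)
    (by linarith) hf
  have a4 := pathIntegral_arc_vec (x := -α) (y := -β) (z := q) (x' := -β) (y' := -α) (z' := -q)
    (m₀ := -r) (m₁ := -r) (m₂ := 0) (w₀ := -D) (w₁ := D) (w₂ := -E) hk hk' (by linarith)
    (by linarith) (by ring) (by linarith) (by linarith) (by linarith) (by linarith) (by linarith)
    (by linarith) hf
  have a5 := pathIntegral_arc_vec (x := -β) (y := -α) (z := -q) (x' := β) (y' := -α) (z' := -q)
    (m₀ := 0) (m₁ := -u) (m₂ := -v) (w₀ := 1) (w₁ := 0) (w₂ := 0) hh hh' (by linarith)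
    (by norm_num) (by ring) (by linarith) (by linarith) (by linarith) (by linarith) (by linarith)
    (by linarith) hf
  have a6 := pathIntegral_arc_vec (x := β) (y := -α) (z := -q) (x' := α) (y' := -β) (z' := q)
    (m₀ := r) (m₁ := -r) (m₂ := 0) (w₀ := -D) (w₁ := -D) (w₂ := E) hk hk' (by linarith)
    (by linarith) (by ring) (by linarith) (by linarith) (by linarith) (by linarith) (by linarith)
    (by linarith) hf
  have a7 := pathIntegral_arc_vec (x := α) (y := -β) (z := q) (x' := α) (y' := β) (z' := q)
    (m₀ := u) (m₁ := 0) (m₂ := v) (w₀ := 0) (w₁ := 1) (w₂ := 0) hh hh' (by linarith)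
    (by norm_num) (by ring) (by linarith) (by linarith) (by linarith) (by linarith) (by linarith)
    (by linarith) hf
  refine (congrArg₂ (· + ·) (congrArg₂ (· + ·) (congrArg₂ (· + ·) (congrArg₂ (· + ·)
    (congrArg₂ (· + ·) (congrArg₂ (· + ·) (congrArg₂ (· + ·) a0 a1) a2) a3) a4) a5) a6) a7).trans ?_
  clear a0 a1 a2 a3 a4 a5 a6 a7
  have hint : ∀ {m₀ m₁ m₂ w₀ w₁ w₂ : ℝ} (l : ℝ), IntervalIntegrable (fun φ : ℝ =>
      f !₂[cos φ * m₀ + sin φ * w₀, cos φ * m₁ + sin φ * w₁, cos φ * m₂ + sin φ * w₂] +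
        f !₂[cos φ * m₀ - sin φ * w₀, cos φ * m₁ - sin φ * w₁, cos φ * m₂ - sin φ * w₂])
      volume 0 l := fun l => Continuous.intervalIntegrable (by fun_prop) _ _
  have e : ∀ a b c d a' b' c' d' : ℝ, a + a' + b + b' + c + c' + d + d' =
      (a' + b' + c' + d') + (a + b + c + d) := fun a b c d a' b' c' d' => by ring
  simp only [e]
  rw [← intervalIntegral.integral_add (hint h) (hint h),
    ← intervalIntegral.integral_add ((hint h).add (hint h)) (hint h),
    ← intervalIntegral.integral_add (((hint h).add (hint h)).add (hint h)) (hint h),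
    ← intervalIntegral.integral_add (hint k) (hint k),
    ← intervalIntegral.integral_add ((hint k).add (hint k)) (hint k),
    ← intervalIntegral.integral_add (((hint k).add (hint k)).add (hint k)) (hint k)]
  congr 1 <;> refine intervalIntegral.integral_congr fun φ _ => ?_ <;>
    simp only [orbitSum] <;> ring_nf

theorem continuous_orbitSum {f : EuclideanSpace ℝ (Fin (2 + 1)) → ℝ} (hf : Continuous f)
    {x y z : ℝ → ℝ} (hx : Continuous x) (hy : Continuous y) (hz : Continuous z) :
    Continuous fun φ => orbitSum f (x φ) (y φ) (z φ) := by
  unfold orbitSum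
  fun_prop

/-- The integrals over the two half arcs, evaluated with explicit antiderivatives. -/
theorem cycleIntegral_of_orbitSum {α β h k u v r D E : ℝ} (hh : 0 < h) (hh' : h < π / 2)
    (hk : 0 < k) (hk' : k < π / 2) (huv : u ^ 2 + v ^ 2 = 1) (hr : r ^ 2 = 1 / 2)
    (hDE : 2 * D ^ 2 + E ^ 2 = 1) (hα : α = cos h * u) (hβ : β = sin h)
    (hq : √(1 - α ^ 2 - β ^ 2) = cos h * v) (hα' : α = cos k * r - sin k * D)
    (hβ' : β = cos k * r + sin k * D) (hq' : √(1 - α ^ 2 - β ^ 2) = sin k * E)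
    {f : EuclideanSpace ℝ (Fin (2 + 1)) → ℝ} (hf : Continuous f)
    {a b c : ℝ} (hsymm : ∀ x y z : ℝ, x ^ 2 + y ^ 2 + z ^ 2 = 1 →
      orbitSum f x y z = a + b * z ^ 2 + c * (z * (x ^ 2 - y ^ 2))) :
    cycleIntegral (cubePoints α β) f = a * (h + k) +
      b * ((v ^ 2 * (h + sin h * cos h) + E ^ 2 * (k - sin k * cos k)) / 2) +
      c * (v * (u ^ 2 * (sin h - sin h ^ 3 / 3) - sin h ^ 3 / 3) -
        4 * r * D * E * sin k ^ 3 / 3) := by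
  rw [cycleIntegral_cubePoints hh hh' hk hk' huv hr hDE hα hβ hq hα' hβ' hq' hf]
  have hs := fun φ : ℝ => hasDerivAt_sin φ
  have hc := fun φ : ℝ => hasDerivAt_cos φ
  have C1 : Continuous fun φ : ℝ => orbitSum f (u * cos φ) (sin φ) (v * cos φ) :=
    continuous_orbitSum hf (by fun_prop) (by fun_prop) (by fun_prop)
  have C2 : Continuous fun φ : ℝ => orbitSum f (r * cos φ + D * sin φ) (r * cos φ - D * sin φ)
      (-(E * sin φ)) := continuous_orbitSum hf (by fun_prop) (by fun_prop) (by fun_prop)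
  have D1 : ∀ φ : ℝ, HasDerivAt (fun φ => a * φ + b * v ^ 2 / 2 * (φ + sin φ * cos φ) +
        c * v * (u ^ 2 * (sin φ - sin φ ^ 3 / 3) - sin φ ^ 3 / 3))
      (orbitSum f (u * cos φ) (sin φ) (v * cos φ)) φ := fun φ => by
    have hid := hasDerivAt_id φ
    have := ((hid.const_mul a).add ((hid.add ((hs φ).mul (hc φ))).const_mul (b * v ^ 2 / 2))).add
      (((((hs φ).sub (((hs φ).pow 3).div_const 3)).const_mul (u ^ 2)).sub
        (((hs φ).pow 3).div_const 3)).const_mul (c * v))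
    refine HasDerivAt.congr_deriv this ?_
    have h1 := sin_sq_add_cos_sq φ
    have h2 : sin φ ^ 2 = 1 - cos φ ^ 2 := by linarith
    rw [hsymm _ _ _ (by linear_combination h1 + cos φ ^ 2 * huv)]
    push_cast
    linear_combination (-(b * v ^ 2 / 2) - c * v * u ^ 2 * cos φ) * h2
  have D2 : ∀ φ : ℝ, HasDerivAt (fun φ => a * φ + b * E ^ 2 / 2 * (φ - sin φ * cos φ) -
        c * (4 * r * D * E) * (sin φ ^ 3 / 3))
      (orbitSum f (r * cos φ + D * sin φ) (r * cos φ - D * sin φ) (-(E * sin φ))) φ := fun φ => by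
    have hid := hasDerivAt_id φ
    have := ((hid.const_mul a).add ((hid.sub ((hs φ).mul (hc φ))).const_mul (b * E ^ 2 / 2))).sub
      ((((hs φ).pow 3).div_const 3).const_mul (c * (4 * r * D * E)))
    refine HasDerivAt.congr_deriv this ?_
    have h1 := sin_sq_add_cos_sq φ
    have h2 : cos φ ^ 2 = 1 - sin φ ^ 2 := by linarith
    rw [hsymm _ _ _ (by linear_combination h1 + sin φ ^ 2 * hDE + 2 * cos φ ^ 2 * hr)]
    push_cast
    linear_combination (-(b * E ^ 2 / 2)) * h2
  rw [intervalIntegral.integral_eq_sub_of_hasDerivAt (fun φ _ => D1 φ) (C1.intervalIntegrable _ _),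
    intervalIntegral.integral_eq_sub_of_hasDerivAt (fun φ _ => D2 φ) (C2.intervalIntegrable _ _)]
  simp only [sin_zero, cos_zero]
  ring

/-- With vanishing moments, the cycle integral depends on `f` only through `a + b / 3`, eight times
the spherical mean of `f`. The other factor is one eighth of the length of the cycle. -/
theorem cycleIntegral_of_moments_eq_zero {α β : ℝ} (hα : 0 < α) (hαβ : α < β)
    (hlt : α ^ 2 + β ^ 2 < 1) (hodd : oddMoment α β = 0) (heven : evenMoment α β = 0)
    {f : EuclideanSpace ℝ (Fin (2 + 1)) → ℝ} (hf : Continuous f)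
    {a b e : ℝ} (hsymm : ∀ x y z : ℝ, x ^ 2 + y ^ 2 + z ^ 2 = 1 →
      orbitSum f x y z = a + b * z ^ 2 + e * (z * (x ^ 2 - y ^ 2))) :
    cycleIntegral (cubePoints α β) f =
      (a + b / 3) * (arcsin β + arccos ((α + β) / √2)) := by
  have hβ0 : 0 < β := hα.trans hαβ
  have hβ1 : β < 1 := by nlinarith
  have h2 : √2 ^ 2 = 2 := Real.sq_sqrt (by norm_num)
  have h20 : 0 < √2 := by positivity
  have hC2 := div_sqrt_two_sq (α + β)
  have hC0 : 0 < (α + β) / √2 := by positivity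
  have hC1 : (α + β) / √2 < 1 := by nlinarith [sq_nonneg (α - β)]
  have hw : √(2 - (α + β) ^ 2) = √2 * √(1 - ((α + β) / √2) ^ 2) := by
    rw [← Real.sqrt_mul (by norm_num), hC2]; congr 1; ring
  have hsinh := sin_arcsin (by linarith : -1 ≤ β) hβ1.le
  have hcosh := cos_arcsin β
  have hcosk := cos_arccos (by linarith : -1 ≤ (α + β) / √2) hC1.le
  have hsink := sin_arccos ((α + β) / √2)
  have hh0 : 0 < arcsin β := arcsin_pos.2 hβ0
  have hh1 : arcsin β < π / 2 := arcsin_lt_pi_div_two.2 hβ1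
  have hk0 : 0 < arccos ((α + β) / √2) := arccos_pos.2 hC1
  have hk1 : arccos ((α + β) / √2) < π / 2 := arccos_lt_pi_div_two.2 hC0
  obtain ⟨c, hcd⟩ : ∃ c, c = √(1 - β ^ 2) := ⟨_, rfl⟩
  obtain ⟨C, hCd⟩ : ∃ C, C = (α + β) / √2 := ⟨_, rfl⟩
  have hc2 : c ^ 2 = 1 - β ^ 2 := by rw [hcd]; exact Real.sq_sqrt (by nlinarith)
  have hc0 : 0 < c := by rw [hcd]; exact Real.sqrt_pos.2 (by nlinarith)
  rw [← hCd] at hC2 hC0 hC1 hw hcosk hsink hk0 hk1 ⊢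
  obtain ⟨S, hSd⟩ : ∃ S, S = √(1 - C ^ 2) := ⟨_, rfl⟩
  obtain ⟨q, hqd⟩ : ∃ q, q = √(1 - α ^ 2 - β ^ 2) := ⟨_, rfl⟩
  obtain ⟨r, hrd⟩ : ∃ r, r = √2 / 2 := ⟨_, rfl⟩
  have hS2 : S ^ 2 = 1 - C ^ 2 := by rw [hSd]; exact Real.sq_sqrt (by nlinarith)
  have hS0 : 0 < S := by rw [hSd]; exact Real.sqrt_pos.2 (by nlinarith)
  have hq2 : q ^ 2 = 1 - α ^ 2 - β ^ 2 := by rw [hqd]; exact Real.sq_sqrt (by linarith)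
  have hr : r ^ 2 = 1 / 2 := by rw [hrd, div_pow, h2]; norm_num
  have hCr : C * r = (α + β) / 2 := by
    rw [hCd, hrd]; field_simp
  rw [oddMoment, hw, ← hcd, ← hSd] at hodd
  rw [evenMoment, ← hCd, ← hcd, ← hSd, ← hc2, ← hS2, ← hq2] at heven
  rw [← hcd] at hcosh
  rw [← hSd] at hsink
  have hz : ((q / c) ^ 2 * (arcsin β + β * c) + (q / S) ^ 2 * (arccos C - S * C)) / 2 =
      (arcsin β + arccos C) / 3 := by
    rw [div_pow, div_pow]
    linarith
  have hxyz : q / c * ((α / c) ^ 2 * (β - β ^ 3 / 3) - β ^ 3 / 3) -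
      4 * r * ((β - α) / (2 * S)) * (q / S) * S ^ 3 / 3 = 0 := by
    have e : q / c * ((α / c) ^ 2 * (β - β ^ 3 / 3) - β ^ 3 / 3) -
      4 * r * ((β - α) / (2 * S)) * (q / S) * S ^ 3 / 3 = q / (3 * c ^ 3) *
        (α ^ 2 * (3 * β - β ^ 3) - β ^ 3 * c ^ 2 - 2 * r * (β - α) * S * c ^ 3) := by
      clear hodd heven hz hw
      field_simp
      ring
    rw [e, hrd, hc2]
    refine mul_eq_zero_of_right _ ?_
    linear_combination hodd
  have hD : 2 * ((β - α) / (2 * S)) ^ 2 + (q / S) ^ 2 = 1 := by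
    have : (β - α) ^ 2 / 2 + q ^ 2 = S ^ 2 := by rw [hq2, hS2, hC2]; ring
    rw [div_pow, div_pow, mul_pow]
    field_simp
    linarith
  -- The midpoints are `(α, 0, q) / c` and `(r, r, 0)`, and the tangent at the second one is
  -- `((β - α) / 2, (α - β) / 2, -q) / S`.
  have hu : (α / c) ^ 2 + (q / c) ^ 2 = 1 := by
    rw [div_pow, div_pow, ← add_div, div_eq_one_iff_eq (by positivity), hq2, hc2]; ring
  have hSD : S * ((β - α) / (2 * S)) = (β - α) / 2 := by field_simp
  have key := cycleIntegral_of_orbitSum (α := α) (u := α / c) (v := q / c) (r := r)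
    (D := (β - α) / (2 * S)) (E := q / S) hh0 hh1 hk0 hk1 hu hr hD
    (by rw [hcosh, mul_div_cancel₀ _ hc0.ne']) hsinh.symm
    (by rw [hcosh, ← hqd, mul_div_cancel₀ _ hc0.ne'])
    (by rw [hcosk, hsink, hCr, hSD]; ring)
    (by rw [hcosk, hsink, hCr, hSD]; ring)
    (by rw [hsink, ← hqd, mul_div_cancel₀ _ hS0.ne']) hf hsymm
  rw [hsinh, hcosh, hcosk, hsink, hz, hxyz] at key
  rw [key]
  ring

theorem isDesign_cubePoints {α β : ℝ} (hα : 0 < α) (hαβ : α < β) (hlt : α ^ 2 + β ^ 2 < 1)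
    (hodd : oddMoment α β = 0) (heven : evenMoment α β = 0) : IsDesign 3 (cubePoints α β) := by
  refine ⟨isControl_cubePoints hα hαβ hlt, fun p hp => ?_⟩
  obtain ⟨a, b, e, habe⟩ := exists_orbitSum_eval hp
  have hcont : Continuous fun y : EuclideanSpace ℝ (Fin (2 + 1)) =>
      MvPolynomial.eval (fun i => y i) p := (MvPolynomial.continuous_eval p).comp (by fun_prop)
  have hlen : cycleLength (cubePoints α β) =
      (8 + 0 / 3) * (arcsin β + arccos ((α + β) / √2)) :=
    cycleIntegral_of_moments_eq_zero hα hαβ hlt hodd heven continuous_const (e := 0)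
      fun x y z _ => by simp only [orbitSum]; ring
  rw [hlen, cycleIntegral_of_moments_eq_zero hα hαβ hlt hodd heven hcont habe,
    sphereIntegral_of_orbitSum hcont habe]
  have h1 : 0 < arcsin β := arcsin_pos.2 (hα.trans hαβ)
  have h2 := arccos_nonneg ((α + β) / √2)
  have : 0 < arcsin β + arccos ((α + β) / √2) := by linarith
  field_simp
  ring

end Cycle

end GeodesicCycle

theorem theorem3p4 :
    ∃ α₀ ∈ Set.Icc (1 / 4 : ℝ) (2 / 5), ∃ β₀ ∈ Set.Icc (1 / 2 : ℝ) (9 / 10),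
      GeodesicCycle.IsDesign 3 (GeodesicCycle.cubePoints α₀ β₀) := by
  obtain ⟨α, hα, β, hβ, h1, h2⟩ := GeodesicCycle.exists_moments_eq_zero
  obtain ⟨hα1, hα2⟩ := hα
  obtain ⟨hβ1, hβ2⟩ := hβ
  exact ⟨α, ⟨hα1, hα2⟩, β, ⟨by linarith, by linarith⟩,
    GeodesicCycle.isDesign_cubePoints (by linarith) (by linarith) (by nlinarith) h1 h2⟩
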